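/- **Theorem 3.6.** Let $\mathbf{k}$ be an algebraically closed field of characteristic $p>0$ and let $A_{1,\mathbf{k}}=\mathbf{k}\langle x,y\rangle/(yx-xy-1)$ be the first Weyl algebra, with the Bernstein filtration $F_d=\{\sum_{i+j\le d}a_{ij}x^iy^j\}$, $d\ge 0$. Let $X_p,Y_p$ be the $p\times p$ matrices over $\mathbf{k}$ of the multiplication by $t$ and of $d/dt$ on $\mathbf{k}[t]/(t^p)$, and for $L=\sum a_{ij}x^iy^j\in A_{1,\mathbf{k}}$ let $$\mathrm{Det}_p(L)=\det\Bigl(\sum a_{ij}(X_p+\tilde x I_p)^i(Y_p+\tilde y I_p)^j\Bigr)\in\mathbf{k}[\tilde x,\tilde y].$$ For $0\neq L\in F_d$ this is a non-zero polynomial of degree at most $d$ in $z_1=\tilde x^p$ and $z_2=\tilde y^p$. Let $\mathfrak{C}_d$ be the projective space of planar algebraic curves of degree at most $d$, that is, of non-zero polynomials in $\mathbf{k}[z_1,z_2]$ of total degree at most $d$ modulo $\mathbf{k}^\times$, and let $$\Theta_d:F_d/\mathbf{k}^\times\to\mathfrak{C}_d,\qquad [L]\mapsto[\mathrm{Det}_p(L)],$$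 where $F_d/\mathbf{k}^\times$ is the projective space of non-zero elements of $F_d$ modulo $\mathbf{k}^\times$. The maps $\Theta_d$ are compatible with the inclusions for $d\le d'$; let $$\Theta:A_{1,\mathbf{k}}/\mathbf{k}^\times=\varinjlim_d F_d/\mathbf{k}^\times\to\mathfrak{C}(\mathbb{A}^2_{\mathbf{k}})=\varinjlim_d\mathfrak{C}_d$$ be their direct limit. Then every $\Theta_d$ is a morphism of projective spaces (given by homogeneous polynomials of one degree without common zeros) and is surjective: every planar curve of degree at most $d$ is the image under $\Theta_d$ of some operator of degree at most $d$. Consequently the morphism $\Theta$ is surjective. -/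

import Mathlib

open scoped LinearAlgebra.Projectivization

noncomputable section

/-! ### The first Weyl algebra -/

/-- The defining relation `y x - x y = 1`; the generator `0` is `x`, the generator `1` is `y`. -/
inductive WeylRel (k : Type*) [CommRing k] :
    FreeAlgebra k (Fin 2) → FreeAlgebra k (Fin 2) → Prop
  | comm : WeylRel k
      (FreeAlgebra.ι k 1 * FreeAlgebra.ι k 0 - FreeAlgebra.ι k 0 * FreeAlgebra.ι k 1) 1

/-- The first Weyl algebra `A_{1,k} = k⟨x, y⟩ / (y x - x y - 1)`. -/
abbrev WeylAlgebra (k : Type*) [CommRing k] : Type _ := RingQuot (WeylRel k)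

namespace WeylAlgebra

section Basic

variable (k : Type*) [CommRing k]

/-- The generator `x`. -/
def x : WeylAlgebra k := RingQuot.mkAlgHom k (WeylRel k) (FreeAlgebra.ι k 0)

/-- The generator `y`, that is `d/dx`. -/
def y : WeylAlgebra k := RingQuot.mkAlgHom k (WeylRel k) (FreeAlgebra.ι k 1)

variable {k}

/-- The universal property of the Weyl algebra. -/
def lift {B : Type*} [Ring B] [Algebra k B] (a b : B) (h : b * a - a * b = 1) :
    WeylAlgebra k →ₐ[k] B :=
  RingQuot.liftAlgHom k (s := WeylRel k)
    ⟨FreeAlgebra.lift k ![a, b], by rintro _ _ ⟨⟩; simpa using h⟩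

theorem lift_x {B : Type*} [Ring B] [Algebra k B] (a b : B) (h : b * a - a * b = 1) :
    lift (k := k) a b h (x k) = a := by
  simp [lift, x]

theorem lift_y {B : Type*} [Ring B] [Algebra k B] (a b : B) (h : b * a - a * b = 1) :
    lift (k := k) a b h (y k) = b := by
  simp [lift, y]

theorem hom_ext {B : Type*} [Ring B] [Algebra k B] {f g : WeylAlgebra k →ₐ[k] B}
    (hx : f (x k) = g (x k)) (hy : f (y k) = g (y k)) : f = g := by
  apply RingQuot.ringQuot_ext'
  apply FreeAlgebra.hom_ext
  funext i
  fin_cases i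
  · exact hx
  · exact hy

variable (k)

/-- The Bernstein filtration: `F_d` consists of the operators `∑_{i + j ≤ d} a_{ij} x^i y^j`. -/
def bernstein (d : ℕ) : Submodule k (WeylAlgebra k) :=
  Submodule.span k {L | ∃ i j : ℕ, i + j ≤ d ∧ L = x k ^ i * y k ^ j}

theorem bernstein_mono : Monotone (bernstein k) := fun _ _ h =>
  Submodule.span_mono fun _ ⟨i, j, hij, hL⟩ => ⟨i, j, hij.trans h, hL⟩

instance (d : ℕ) : Module.Finite k (bernstein k d) := by
  refine Module.Finite.span_of_finite k (Set.Finite.subset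
    (((Set.finite_Iic d).prod (Set.finite_Iic d)).image
      fun q : ℕ × ℕ => x k ^ q.1 * y k ^ q.2) ?_)
  rintro _ ⟨i, j, hij, rfl⟩
  exact ⟨(i, j), ⟨by simp; omega, by simp; omega⟩, rfl⟩

end Basic

/-! ### The `p`-determinant -/

/-- Multiplication by `x` on `k[x]/(x^p)`, in the basis `1, x, …, x^(p-1)`. -/
def matX (k : Type*) [CommRing k] (p : ℕ) : Matrix (Fin p) (Fin p) k :=
  Matrix.of fun i j => if (i : ℕ) = j + 1 then 1 else 0

/-- Differentiation on `k[x]/(x^p)` (with `p = 0` in `k`), in the basis `1, x, …, x^(p-1)`. -/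
def matY (k : Type*) [CommRing k] (p : ℕ) : Matrix (Fin p) (Fin p) k :=
  Matrix.of fun i j => if (j : ℕ) = i + 1 then ((j : ℕ) : k) else 0

theorem matY_mul_matX_sub (k : Type*) [CommRing k] (p : ℕ) [CharP k p] :
    matY k p * matX k p - matX k p * matY k p = 1 := by
  ext a b
  have hb := b.2
  have h1 : (matY k p * matX k p) a b =
      if a = b then (if (b : ℕ) + 1 < p then ((b : ℕ) + 1 : k) else 0) else 0 := by
    simp only [matY, matX, Matrix.mul_apply, Matrix.of_apply, mul_ite, mul_one, mul_zero]
    by_cases hp : (b : ℕ) + 1 < p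
    · rw [Finset.sum_eq_single (⟨b + 1, hp⟩ : Fin p)]
      · simp [hp, Fin.ext_iff, eq_comm]
      · intro c _ hc
        rw [if_neg]
        intro h
        exact hc (Fin.ext h)
      · simp
    · rw [Finset.sum_eq_zero]
      · simp [hp]
      · intro c _
        rw [if_neg]
        have := c.2
        omega
  have h2 : (matX k p * matY k p) a b = if a = b then ((b : ℕ) : k) else 0 := by
    simp only [matY, matX, Matrix.mul_apply, Matrix.of_apply, ite_mul, one_mul, zero_mul]
    by_cases ha : (a : ℕ) = 0
    · rw [Finset.sum_eq_zero]
      · split_ifs with hab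
        · subst hab; simp [ha]
        · rfl
      · intro c _
        rw [if_neg]
        omega
    · have ha' := a.2
      rw [Finset.sum_eq_single (⟨a - 1, by omega⟩ : Fin p)]
      · have e : (a : ℕ) - 1 + 1 = a := by omega
        simp only [e, if_true, Fin.ext_iff]
        simp [eq_comm]
      · intro c _ hc
        rw [if_neg]
        intro h
        apply hc
        ext
        simp [h]
      · simp
  rw [Matrix.sub_apply, h1, h2, Matrix.one_apply]
  by_cases hab : a = b
  · simp only [hab, if_true]
    by_cases hp : (b : ℕ) + 1 < p
    · simp [hp]
    · have e : (b : ℕ) + 1 = p := by omega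
      have : ((b : ℕ) : k) + 1 = 0 := by
        rw [← Nat.cast_add_one, e, CharP.cast_eq_zero]
      simp only [hp, if_false]
      linear_combination -this
  · simp [hab]

section PDet

variable (k : Type*) [CommRing k] (p : ℕ) [CharP k p]

open MvPolynomial in
/-- The splitting of the Weyl algebra over the extended centre `k[x̃, ỹ]`
(`x̃ = X 0`, `ỹ = X 1`): the homomorphism to `p × p` matrices over `k[x̃, ỹ]` with
`x ↦ X_p + x̃ I_p` and `y ↦ Y_p + ỹ I_p`. -/
def splitting : WeylAlgebra k →ₐ[k] Matrix (Fin p) (Fin p) (MvPolynomial (Fin 2) k) :=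
  lift ((matX k p).map C + Matrix.scalar (Fin p) (X 0))
    ((matY k p).map C + Matrix.scalar (Fin p) (X 1)) (by
      have h := congrArg (fun M => M.map (C : k →+* MvPolynomial (Fin 2) k))
        (matY_mul_matX_sub k p)
      simp only [Matrix.map_sub _ (map_sub C), Matrix.map_mul,
        Matrix.map_one _ (map_zero C) (map_one C)] at h
      have c0 : ∀ (r : MvPolynomial (Fin 2) k) (M : Matrix (Fin p) (Fin p) _),
          Matrix.scalar (Fin p) r * M = M * Matrix.scalar (Fin p) r := fun r M =>
        (Matrix.scalar_commute r (fun r' => mul_comm _ _) M).eq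
      simp only [add_mul, mul_add, c0 _ ((matX k p).map C), c0 _ ((matY k p).map C),
        c0 (X 1) (Matrix.scalar (Fin p) (X 0))]
      rw [← h]
      abel)

/-- The `p`-determinant
`Det_p (∑ a_{ij} x^i y^j) = det (∑ a_{ij} (X_p + x̃ I_p)^i (Y_p + ỹ I_p)^j)`,
a polynomial in `x̃ = X 0` and `ỹ = X 1`. -/
def pDet (L : WeylAlgebra k) : MvPolynomial (Fin 2) k := (splitting k p L).det

theorem splitting_x : splitting k p (x k) =
    (matX k p).map MvPolynomial.C + Matrix.scalar (Fin p) (MvPolynomial.X 0) := lift_x ..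

theorem splitting_y : splitting k p (y k) =
    (matY k p).map MvPolynomial.C + Matrix.scalar (Fin p) (MvPolynomial.X 1) := lift_y ..

theorem pDet_smul (c : k) (L : WeylAlgebra k) : pDet k p (c • L) = c ^ p • pDet k p L := by
  simp only [pDet, map_smul, Matrix.det_smul_of_tower, Fintype.card_fin]

end PDet

/-! ### The `p`-determinant is a polynomial in `x̃^p` and `ỹ^p` -/

/-- The substitution `X i ↦ X i + ε` over the dual numbers. -/
def dualShift (k : Type*) [CommRing k] (i : Fin 2) :
    MvPolynomial (Fin 2) k →ₐ[k] TrivSqZeroExt (MvPolynomial (Fin 2) k) (MvPolynomial (Fin 2) k) :=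
  MvPolynomial.aeval fun j =>
    TrivSqZeroExt.inl (MvPolynomial.X j) + TrivSqZeroExt.inr (if j = i then 1 else 0)

theorem dualShift_apply (k : Type*) [CommRing k] (i : Fin 2) (f : MvPolynomial (Fin 2) k) :
    dualShift k i f = TrivSqZeroExt.inl f + TrivSqZeroExt.inr (MvPolynomial.pderiv i f) := by
  induction f using MvPolynomial.induction_on with
  | C a => simp [dualShift]; rfl
  | add f g hf hg =>
    simp only [map_add, hf, hg, TrivSqZeroExt.inl_add, TrivSqZeroExt.inr_add]; abel
  | mul_X f j hf =>
    rw [map_mul, hf]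
    by_cases h : j = i
    · subst h
      apply TrivSqZeroExt.ext <;> simp [dualShift, mul_comm, add_comm]
    · apply TrivSqZeroExt.ext <;>
        simp [dualShift, mul_comm, h, MvPolynomial.pderiv_X_of_ne h]

theorem pderiv_pDet_of_conj (k : Type*) [CommRing k] (p : ℕ) [CharP k p] (i : Fin 2)
    (N : Matrix (Fin p) (Fin p) (MvPolynomial (Fin 2) k))
    (hx : N * splitting k p (x k) - splitting k p (x k) * N = if i = 0 then 1 else 0)
    (hy : N * splitting k p (y k) - splitting k p (y k) * N = if i = 1 then 1 else 0)
    (L : WeylAlgebra k) : MvPolynomial.pderiv i (pDet k p L) = 0 := by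
  let R := MvPolynomial (Fin 2) k
  let ι : Matrix (Fin p) (Fin p) R →ₐ[k] Matrix (Fin p) (Fin p) (TrivSqZeroExt R R) :=
    (TrivSqZeroExt.inlAlgHom k R R).mapMatrix
  let e : Matrix (Fin p) (Fin p) (TrivSqZeroExt R R) :=
    Matrix.scalar (Fin p) (TrivSqZeroExt.inr (1 : R))
  have he : ∀ M, e * M = M * e := fun M =>
    (Matrix.scalar_commute _ (fun _ => Commute.all _ _) M).eq
  have hee : e * e = 0 := by
    simp only [e, ← map_mul, TrivSqZeroExt.inr_mul_inr, map_zero]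
  have key : ∀ A B : Matrix (Fin p) (Fin p) (TrivSqZeroExt R R), A * e * (B * e) = 0 := by
    intro A B
    rw [mul_assoc, ← mul_assoc e, he, mul_assoc B, hee]; simp
  let U := 1 + ι N * e
  let V := 1 - ι N * e
  have hUV : V * U = 1 := by
    simp only [U, V, sub_mul, mul_add, key, one_mul, mul_one]; abel
  have hVU : U * V = 1 := by
    simp only [U, V, add_mul, mul_sub, key, one_mul, mul_one]; abel
  let β : WeylAlgebra k →ₐ[k] Matrix (Fin p) (Fin p) (TrivSqZeroExt R R) :=
    AlgHom.ofLinearMap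
      ((LinearMap.mulLeft k U).comp ((LinearMap.mulRight k V).comp
        (ι.comp (splitting k p)).toLinearMap))
      (by simp [hVU])
      (by
        intro a b
        simp only [LinearMap.comp_apply, LinearMap.mulLeft_apply, LinearMap.mulRight_apply,
          AlgHom.toLinearMap_apply, map_mul]
        calc _ = U * (ι.comp (splitting k p) a * 1 * ι.comp (splitting k p) b) * V := by
              simp only [mul_one, mul_assoc]
          _ = _ := by rw [← hUV]; simp only [mul_assoc])
  have hβ : ∀ a, β a = ι (splitting k p a) +
      ι (N * splitting k p a - splitting k p a * N) * e := by
    intro a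
    change U * (ι (splitting k p a) * V) = _
    have h1 : ∀ M, ι N * e * (M * (ι N * e)) = 0 := fun M => by
      rw [← mul_assoc M]; exact key _ _
    simp only [U, V, add_mul, mul_sub, h1, one_mul, mul_one, map_sub, map_mul, sub_mul]
    rw [mul_assoc (ι N) e, he, ← mul_assoc, ← mul_assoc]
    abel
  have hshift : ∀ j : Fin 2, ∀ M : Matrix (Fin p) (Fin p) k,
      (dualShift k i).mapMatrix
        (M.map MvPolynomial.C + Matrix.scalar (Fin p) (MvPolynomial.X j)) =
      ι (M.map MvPolynomial.C + Matrix.scalar (Fin p) (MvPolynomial.X j)) +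
      ι (if i = j then 1 else 0) * e := by
    intro j M
    ext1 a b
    have hd : (ι (if i = j then 1 else 0) * e) a b =
        TrivSqZeroExt.inr (if a = b then (if i = j then 1 else 0) else 0) := by
      split_ifs <;> simp [e, *]
    rw [Matrix.add_apply, hd]
    change dualShift k i _ = TrivSqZeroExt.inl _ + _
    rw [dualShift_apply]
    congr 2
    by_cases hab : a = b
    · subst hab
      by_cases hij : i = j
      · subst hij; simp
      · simp [hij, MvPolynomial.pderiv_X_of_ne (Ne.symm hij)]
    · simp [hab]
  have hαβ : (dualShift k i).mapMatrix.comp (splitting k p) = β := by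
    apply hom_ext
    · rw [hβ, hx, AlgHom.comp_apply, splitting_x, hshift]
    · rw [hβ, hy, AlgHom.comp_apply, splitting_y, hshift]
  have h := congrArg Matrix.det (DFunLike.congr_fun hαβ L)
  have h2 : (β L).det = (ι (splitting k p L)).det := by
    change (U * (ι (splitting k p L) * V)).det = _
    rw [Matrix.det_mul, Matrix.det_mul, mul_left_comm, ← Matrix.det_mul, hVU, Matrix.det_one,
      mul_one]
  rw [h2, AlgHom.comp_apply, ← AlgHom.map_det, ← AlgHom.map_det, dualShift_apply] at h
  have h3 := congrArg TrivSqZeroExt.snd h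
  simpa [pDet] using h3

theorem pderiv_pDet (k : Type*) [CommRing k] (p : ℕ) [CharP k p] (i : Fin 2)
    (L : WeylAlgebra k) : MvPolynomial.pderiv i (pDet k p L) = 0 := by
  have hc : splitting k p (y k) * splitting k p (x k) -
      splitting k p (x k) * splitting k p (y k) = 1 := by
    rw [← map_mul, ← map_mul, ← map_sub, ← map_one (splitting k p)]
    congr 1
    have := RingQuot.mkAlgHom_rel k (WeylRel.comm (k := k))
    simpa [x, y] using this
  fin_cases i
  · refine pderiv_pDet_of_conj k p 0 (splitting k p (y k)) ?_ ?_ L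
    · simpa using hc
    · simp
  · refine pderiv_pDet_of_conj k p 1 (-splitting k p (x k)) ?_ ?_ L
    · simp
    · rw [if_pos rfl, ← hc]; noncomm_ring

/-- The `p`-determinant is a polynomial in `x̃^p` and `ỹ^p`. -/
theorem exists_expand_eq_pDet (k : Type*) [CommRing k] [NoZeroDivisors k] (p : ℕ) [Fact p.Prime]
    [CharP k p] (L : WeylAlgebra k) :
    ∃ f : MvPolynomial (Fin 2) k, MvPolynomial.expand p f = pDet k p L := by
  have hdvd : ∀ m : Fin 2 →₀ ℕ, MvPolynomial.coeff m (pDet k p L) ≠ 0 → ∀ i, p ∣ m i := by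
    intro m hm i
    by_contra hn
    have h0 : m i ≠ 0 := fun h => hn (h ▸ dvd_zero p)
    have h1 := congrArg (MvPolynomial.coeff (m - Finsupp.single i 1)) (pderiv_pDet k p i L)
    have h2 : m - Finsupp.single i 1 + Finsupp.single i 1 = m := by
      ext j
      by_cases hj : i = j
      · subst hj; simp; omega
      · simp [hj]
    rw [MvPolynomial.coeff_pderiv, h2, MvPolynomial.coeff_zero] at h1
    have h3 : (((m - Finsupp.single i 1 : Fin 2 →₀ ℕ) i : ℕ) : k) + 1 = ((m i : ℕ) : k) := by
      rw [← Nat.cast_add_one]; congr 1; simp; omega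
    rw [h3] at h1
    rcases mul_eq_zero.1 h1 with h | h
    · exact hm h
    · exact hn ((CharP.cast_eq_zero_iff k p _).1 h)
  refine ⟨∑ m ∈ (pDet k p L).support, MvPolynomial.monomial
    (m.mapRange (· / p) (Nat.zero_div p)) (MvPolynomial.coeff m (pDet k p L)), ?_⟩
  conv_rhs => rw [MvPolynomial.as_sum (pDet k p L)]
  rw [map_sum]
  refine Finset.sum_congr rfl fun m hm => ?_
  rw [MvPolynomial.expand_monomial]
  refine congrArg (fun n => MvPolynomial.monomial n _) (Finsupp.ext fun i => ?_)
  simpa using Nat.mul_div_cancel' (hdvd m (MvPolynomial.mem_support_iff.1 hm) i)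

/-! ### Degree and non-vanishing of the `p`-determinant -/

theorem homogeneousComponent_mul_top {k : Type*} [CommRing k] {m n : ℕ}
    {f g : MvPolynomial (Fin 2) k} (hf : f.totalDegree ≤ m) (hg : g.totalDegree ≤ n) :
    MvPolynomial.homogeneousComponent (m + n) (f * g) =
      MvPolynomial.homogeneousComponent m f * MvPolynomial.homogeneousComponent n g := by
  have hs : ∀ {f : MvPolynomial (Fin 2) k} {m : ℕ}, f.totalDegree ≤ m →
      f = ∑ i ∈ Finset.range (m + 1), MvPolynomial.homogeneousComponent i f := by
    intro f m hf
    conv_lhs => rw [← MvPolynomial.sum_homogeneousComponent f]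
    refine Finset.sum_subset (Finset.range_mono (by omega)) fun i _ hi => ?_
    exact MvPolynomial.homogeneousComponent_eq_zero _ _ (by simpa using hi)
  conv_lhs => rw [hs hf, hs hg, Finset.sum_mul_sum, map_sum]
  simp only [map_sum]
  rw [Finset.sum_eq_single m, Finset.sum_eq_single n]
  · rw [MvPolynomial.homogeneousComponent_of_mem ((MvPolynomial.homogeneousComponent_isHomogeneous
      m f).mul (MvPolynomial.homogeneousComponent_isHomogeneous n g)), if_pos rfl]
  · intro j hj hj'
    rw [MvPolynomial.homogeneousComponent_of_mem ((MvPolynomial.homogeneousComponent_isHomogeneous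
      m f).mul (MvPolynomial.homogeneousComponent_isHomogeneous j g)), if_neg (by omega)]
  · simp
  · intro i hi hi'
    refine Finset.sum_eq_zero fun j hj => ?_
    simp only [Finset.mem_range] at hi hj
    rw [MvPolynomial.homogeneousComponent_of_mem ((MvPolynomial.homogeneousComponent_isHomogeneous
      i f).mul (MvPolynomial.homogeneousComponent_isHomogeneous j g)), if_neg (by omega)]
  · simp

/-- The entries of `M` have degree at most `n`, and their part of degree `n` is `c I`. -/
def HasTop {k : Type*} [CommRing k] {p : ℕ} (n : ℕ) (c : MvPolynomial (Fin 2) k)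
    (M : Matrix (Fin p) (Fin p) (MvPolynomial (Fin 2) k)) : Prop :=
  ∀ a b, (M a b).totalDegree ≤ n ∧
    MvPolynomial.homogeneousComponent n (M a b) = if a = b then c else 0

theorem HasTop.mul {k : Type*} [CommRing k] {p m n : ℕ} {c d : MvPolynomial (Fin 2) k}
    {M N : Matrix (Fin p) (Fin p) (MvPolynomial (Fin 2) k)} (hM : HasTop m c M)
    (hN : HasTop n d N) : HasTop (m + n) (c * d) (M * N) := by
  intro a b
  rw [Matrix.mul_apply]
  refine ⟨MvPolynomial.totalDegree_finsetSum_le fun i _ =>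
    (MvPolynomial.totalDegree_mul _ _).trans (add_le_add (hM a i).1 (hN i b).1), ?_⟩
  rw [map_sum]
  simp only [homogeneousComponent_mul_top (hM _ _).1 (hN _ _).1, (hM _ _).2, (hN _ _).2]
  simp

theorem HasTop.one {k : Type*} [CommRing k] {p : ℕ} :
    HasTop 0 1 (1 : Matrix (Fin p) (Fin p) (MvPolynomial (Fin 2) k)) := by
  intro a b
  rw [Matrix.one_apply]
  split_ifs <;> simp

theorem HasTop.pow {k : Type*} [CommRing k] {p m : ℕ} {c : MvPolynomial (Fin 2) k}
    {M : Matrix (Fin p) (Fin p) (MvPolynomial (Fin 2) k)} (hM : HasTop m c M) (j : ℕ) :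
    HasTop (j * m) (c ^ j) (M ^ j) := by
  induction j with
  | zero => simpa using HasTop.one
  | succ j ih => simpa [pow_succ, add_mul] using ih.mul hM

theorem HasTop.add {k : Type*} [CommRing k] {p n : ℕ} {c d : MvPolynomial (Fin 2) k}
    {M N : Matrix (Fin p) (Fin p) (MvPolynomial (Fin 2) k)} (hM : HasTop n c M)
    (hN : HasTop n d N) : HasTop n (c + d) (M + N) := by
  intro a b
  rw [Matrix.add_apply]
  refine ⟨(MvPolynomial.totalDegree_add _ _).trans (max_le (hM a b).1 (hN a b).1), ?_⟩
  rw [map_add, (hM a b).2, (hN a b).2]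
  split_ifs <;> simp

theorem HasTop.smul {k : Type*} [CommRing k] {p n : ℕ} {c : MvPolynomial (Fin 2) k}
    {M : Matrix (Fin p) (Fin p) (MvPolynomial (Fin 2) k)} (hM : HasTop n c M) (r : k) :
    HasTop n (r • c) (r • M) := by
  intro a b
  rw [Matrix.smul_apply]
  refine ⟨(MvPolynomial.totalDegree_smul_le _ _).trans (hM a b).1, ?_⟩
  rw [map_smul, (hM a b).2]
  split_ifs <;> simp

theorem HasTop.zero {k : Type*} [CommRing k] {p n : ℕ} :
    HasTop n 0 (0 : Matrix (Fin p) (Fin p) (MvPolynomial (Fin 2) k)) := by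
  intro a b
  simp

theorem HasTop.of_lt {k : Type*} [CommRing k] {p m n : ℕ} {c : MvPolynomial (Fin 2) k}
    {M : Matrix (Fin p) (Fin p) (MvPolynomial (Fin 2) k)} (hM : HasTop m c M) (h : m < n) :
    HasTop n 0 M := by
  intro a b
  refine ⟨(hM a b).1.trans h.le, ?_⟩
  rw [MvPolynomial.homogeneousComponent_eq_zero _ _ ((hM a b).1.trans_lt h)]
  simp

theorem HasTop.scalar_X {k : Type*} [CommRing k] {p : ℕ} (M : Matrix (Fin p) (Fin p) k)
    (i : Fin 2) :
    HasTop 1 (MvPolynomial.X i)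
      (M.map MvPolynomial.C + Matrix.scalar (Fin p) (MvPolynomial.X i)) := by
  have h0 : HasTop 1 0 (M.map (MvPolynomial.C : k →+* MvPolynomial (Fin 2) k)) := by
    intro a b
    refine ⟨by simp, ?_⟩
    rw [MvPolynomial.homogeneousComponent_eq_zero _ _ (by simp)]
    simp
  have h1 : HasTop 1 (MvPolynomial.X i : MvPolynomial (Fin 2) k)
      (Matrix.scalar (Fin p) (MvPolynomial.X i)) := by
    intro a b
    by_cases hab : a = b
    · subst hab
      have hX := MvPolynomial.isHomogeneous_X k i
      simp only [Matrix.scalar_apply, Matrix.diagonal_apply_eq, if_true]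
      exact ⟨hX.totalDegree_le, by rw [MvPolynomial.homogeneousComponent_of_mem hX, if_pos rfl]⟩
    · simp [hab]
  simpa using h0.add h1

theorem HasTop.det {k : Type*} [CommRing k] {p n : ℕ} {c : MvPolynomial (Fin 2) k}
    {M : Matrix (Fin p) (Fin p) (MvPolynomial (Fin 2) k)} (hM : HasTop n c M) :
    M.det.totalDegree ≤ p * n ∧ MvPolynomial.homogeneousComponent (p * n) M.det = c ^ p := by
  have hprod : ∀ (f g : Fin p → Fin p) (s : Finset (Fin p)),
      (∏ i ∈ s, M (f i) (g i)).totalDegree ≤ s.card * n ∧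
      MvPolynomial.homogeneousComponent (s.card * n) (∏ i ∈ s, M (f i) (g i)) =
        ∏ i ∈ s, (c • (1 : Matrix (Fin p) (Fin p) (MvPolynomial (Fin 2) k))) (f i) (g i) := by
    intro f g s
    induction s using Finset.induction_on with
    | empty => simp
    | insert a s ha ih =>
      rw [Finset.prod_insert ha, Finset.prod_insert ha, Finset.card_insert_of_notMem ha,
        add_mul, one_mul, add_comm]
      refine ⟨(MvPolynomial.totalDegree_mul _ _).trans (add_le_add (hM _ _).1 ih.1), ?_⟩
      rw [homogeneousComponent_mul_top (hM _ _).1 ih.1, ih.2, (hM _ _).2]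
      simp [Matrix.one_apply]
  have hsmul : ∀ (σ : Equiv.Perm (Fin p)) (f : MvPolynomial (Fin 2) k),
      Equiv.Perm.sign σ • f = ((Equiv.Perm.sign σ : ℤ) : k) • f := by
    intro σ f
    rw [Units.smul_def, Int.cast_smul_eq_zsmul]
  have hone : c ^ p = (c • (1 : Matrix (Fin p) (Fin p) (MvPolynomial (Fin 2) k))).det := by
    simp
  rw [hone, Matrix.det_apply, Matrix.det_apply]
  constructor
  · refine MvPolynomial.totalDegree_finsetSum_le fun σ _ => ?_
    rw [hsmul]
    refine (MvPolynomial.totalDegree_smul_le _ _).trans ?_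
    simpa using (hprod (fun i => σ i) (fun i => i) Finset.univ).1
  · rw [map_sum]
    refine Finset.sum_congr rfl fun σ _ => ?_
    have h := (hprod (fun i => σ i) (fun i => i) Finset.univ).2
    rw [Finset.card_univ, Fintype.card_fin] at h
    rw [hsmul, hsmul, map_smul, h]

/-- The operator `∑ a_{ij} x^i y^j` with the coefficients of the polynomial `∑ a_{ij} X_0^i X_1^j`. -/
def normalOrder (k : Type*) [CommRing k] : MvPolynomial (Fin 2) k →ₗ[k] WeylAlgebra k :=
  (MvPolynomial.basisMonomials (Fin 2) k).constr k fun m => x k ^ m 0 * y k ^ m 1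

theorem normalOrder_monomial (k : Type*) [CommRing k] (m : Fin 2 →₀ ℕ) (r : k) :
    normalOrder k (MvPolynomial.monomial m r) = r • (x k ^ m 0 * y k ^ m 1) := by
  have h : MvPolynomial.monomial m r = r • MvPolynomial.basisMonomials (Fin 2) k m := by
    simp [MvPolynomial.smul_monomial]
  rw [h, map_smul, normalOrder, Module.Basis.constr_basis]

theorem exists_normalOrder_eq (k : Type*) [CommRing k] (d : ℕ) (L : WeylAlgebra k)
    (hL : L ∈ bernstein k d) :
    ∃ f : MvPolynomial (Fin 2) k, f.totalDegree ≤ d ∧ normalOrder k f = L := by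
  have h : bernstein k d ≤
      (MvPolynomial.restrictTotalDegree (Fin 2) k d).map (normalOrder k) := by
    refine Submodule.span_le.2 ?_
    rintro _ ⟨i, j, hij, rfl⟩
    refine ⟨MvPolynomial.monomial (Finsupp.single 0 i + Finsupp.single 1 j) 1, ?_, ?_⟩
    · rw [SetLike.mem_coe, MvPolynomial.mem_restrictTotalDegree]
      refine (MvPolynomial.totalDegree_monomial_le _ _).trans ?_
      rw [Finsupp.sum_fintype _ _ (fun _ => rfl)]
      simpa [Fin.sum_univ_two] using hij
    · simp [normalOrder_monomial]
  obtain ⟨f, hf, rfl⟩ := h hL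
  exact ⟨f, (MvPolynomial.mem_restrictTotalDegree _ _ _).1 hf, rfl⟩

theorem hasTop_normalOrder (k : Type*) [CommRing k] (p : ℕ) [CharP k p] (n : ℕ)
    (f : MvPolynomial (Fin 2) k) (hf : f.totalDegree ≤ n) :
    HasTop n (MvPolynomial.homogeneousComponent n f) (splitting k p (normalOrder k f)) := by
  have hmon : ∀ m : Fin 2 →₀ ℕ, ∀ r : k, m.degree ≤ n →
      HasTop n (MvPolynomial.homogeneousComponent n (MvPolynomial.monomial m r))
        (splitting k p (normalOrder k (MvPolynomial.monomial m r))) := by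
    intro m r hm
    have hd : m 0 + m 1 = m.degree := by
      rw [Finsupp.degree_eq_sum, Fin.sum_univ_two]
    have h1 : HasTop m.degree (MvPolynomial.monomial m r)
        (splitting k p (normalOrder k (MvPolynomial.monomial m r))) := by
      have := (((HasTop.scalar_X (matX k p) 0).pow (m 0)).mul
        ((HasTop.scalar_X (matY k p) 1).pow (m 1))).smul r
      rw [← splitting_x, ← splitting_y, ← map_pow, ← map_pow, ← map_mul, ← map_smul,
        ← normalOrder_monomial, mul_one, mul_one, hd] at this
      convert this using 1
      rw [MvPolynomial.monomial_eq, Finsupp.prod_fintype _ _ (fun _ => pow_zero _),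
        Fin.prod_univ_two, MvPolynomial.smul_eq_C_mul]
    have hh : (MvPolynomial.monomial m r).IsHomogeneous m.degree :=
      MvPolynomial.isHomogeneous_monomial r rfl
    rw [MvPolynomial.homogeneousComponent_of_mem hh]
    rcases hm.lt_or_eq with h | h
    · rw [if_neg (by omega)]
      exact h1.of_lt h
    · rw [if_pos h.symm, ← h]
      exact h1
  have hsum : ∀ s : Finset (Fin 2 →₀ ℕ), s ⊆ f.support →
      HasTop n (MvPolynomial.homogeneousComponent n
        (∑ m ∈ s, MvPolynomial.monomial m (MvPolynomial.coeff m f)))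
        (splitting k p (normalOrder k
          (∑ m ∈ s, MvPolynomial.monomial m (MvPolynomial.coeff m f)))) := by
    intro s
    induction s using Finset.induction_on with
    | empty => intro _; simpa using HasTop.zero
    | insert a s ha ih =>
      intro hs
      rw [Finset.sum_insert ha, map_add, map_add, map_add]
      refine (hmon _ _ ?_).add (ih fun _ h => hs (Finset.mem_insert_of_mem h))
      refine le_trans ?_ hf
      have := MvPolynomial.le_totalDegree (hs (Finset.mem_insert_self a s))
      exact this
  have := hsum f.support subset_rfl
  rwa [← MvPolynomial.as_sum f] at this

theorem totalDegree_pDet_le (k : Type*) [CommRing k] (p : ℕ) [CharP k p] (d : ℕ)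
    (L : WeylAlgebra k) (hL : L ∈ bernstein k d) : (pDet k p L).totalDegree ≤ p * d := by
  obtain ⟨f, hf, rfl⟩ := exists_normalOrder_eq k d L hL
  exact (hasTop_normalOrder k p d f hf).det.1

theorem pDet_ne_zero (k : Type*) [CommRing k] [IsDomain k] (p : ℕ) [CharP k p] (d : ℕ)
    (L : WeylAlgebra k) (hL : L ∈ bernstein k d) (h0 : L ≠ 0) : pDet k p L ≠ 0 := by
  obtain ⟨f, hf, rfl⟩ := exists_normalOrder_eq k d L hL
  have hf0 : f ≠ 0 := by rintro rfl; simp at h0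
  intro h
  have h1 := (hasTop_normalOrder k p f.totalDegree f le_rfl).det.2
  rw [← pDet, h, map_zero] at h1
  have h2 : MvPolynomial.homogeneousComponent f.totalDegree f = 0 := by
    by_contra hne
    exact pow_ne_zero p hne h1.symm
  obtain ⟨m, hm, hm'⟩ := f.support.exists_mem_eq_sup
    (MvPolynomial.support_nonempty.2 hf0) (fun m => m.sum fun _ e => e)
  have h3 := congrArg (MvPolynomial.coeff m) h2
  rw [MvPolynomial.coeff_homogeneousComponent, if_pos, MvPolynomial.coeff_zero] at h3
  · exact MvPolynomial.mem_support_iff.1 hm h3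
  · rw [MvPolynomial.totalDegree, hm']
    rfl

/-! ### The curve of an operator -/

section Curve

variable (k : Type*) [Field k] (p : ℕ) [Fact p.Prime] [CharP k p]

/-- The `p`-determinant as a polynomial in `z₁ = x̃^p` and `z₂ = ỹ^p`. It is the unique
polynomial satisfying `expand_curvePoly`, because `MvPolynomial.expand p` is injective. -/
def curvePoly (L : WeylAlgebra k) : MvPolynomial (Fin 2) k :=
  (exists_expand_eq_pDet k p L).choose

theorem expand_curvePoly (L : WeylAlgebra k) :
    MvPolynomial.expand p (curvePoly k p L) = pDet k p L :=
  (exists_expand_eq_pDet k p L).choose_spec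

theorem curvePoly_smul (c : k) (L : WeylAlgebra k) :
    curvePoly k p (c • L) = c ^ p • curvePoly k p L := by
  apply MvPolynomial.expand_injective (Fact.out : p.Prime).pos
  rw [map_smul, expand_curvePoly, expand_curvePoly, pDet_smul]

theorem curvePoly_mem {d : ℕ} {L : WeylAlgebra k} (hL : L ∈ bernstein k d) :
    curvePoly k p L ∈ MvPolynomial.restrictTotalDegree (Fin 2) k d := by
  rw [MvPolynomial.mem_restrictTotalDegree]
  have h := totalDegree_pDet_le k p d L hL
  rw [← expand_curvePoly, MvPolynomial.totalDegree_expand, mul_comm] at h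
  exact Nat.le_of_mul_le_mul_left h (Fact.out : p.Prime).pos

theorem curvePoly_ne_zero {d : ℕ} {L : WeylAlgebra k} (hL : L ∈ bernstein k d) (h0 : L ≠ 0) :
    curvePoly k p L ≠ 0 := by
  intro h
  apply pDet_ne_zero k p d L hL h0
  rw [← expand_curvePoly, h, map_zero]

end Curve

end WeylAlgebra

/-! ### Operators and planar curves modulo scalars, and the map `Θ` -/

/-- `F_d / k^×`: operators of degree at most `d` modulo non-zero constants. -/
abbrev OperatorSpace (k : Type*) [Field k] (d : ℕ) : Type _ :=
  ℙ k (WeylAlgebra.bernstein k d)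

/-- `𝔠_d`: planar algebraic curves of degree at most `d`, a curve being a non-zero polynomial in
`z₁ = X 0` and `z₂ = X 1` modulo non-zero constants. -/
abbrev CurveSpace (k : Type*) [Field k] (d : ℕ) : Type _ :=
  ℙ k (MvPolynomial.restrictTotalDegree (Fin 2) k d)

/-- The embedding of projective spaces induced by an inclusion of subspaces. -/
def projInclusion {k V : Type*} [Field k] [AddCommGroup V] [Module k V] {S T : Submodule k V}
    (h : S ≤ T) : ℙ k S ↪ ℙ k T where
  toFun := Projectivization.map (Submodule.inclusion h) (Submodule.inclusion_injective h)
  inj' := Projectivization.map_injective _ _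

theorem restrictTotalDegree_mono (k : Type*) [Field k] :
    Monotone (MvPolynomial.restrictTotalDegree (Fin 2) k) := fun _ _ h _ hf =>
  (MvPolynomial.mem_restrictTotalDegree _ _ _).2
    (((MvPolynomial.mem_restrictTotalDegree _ _ _).1 hf).trans h)

/-- The transition maps `μ_{dd'} : F_d / k^× → F_{d'} / k^×`. -/
def operatorEmb (k : Type*) [Field k] (d d' : ℕ) (h : d ≤ d') :
    OperatorSpace k d ↪ OperatorSpace k d' :=
  projInclusion (WeylAlgebra.bernstein_mono k h)

/-- The transition maps `ν_{dd'} : 𝔠_d → 𝔠_{d'}`. -/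
def curveEmb (k : Type*) [Field k] (d d' : ℕ) (h : d ≤ d') :
    CurveSpace k d ↪ CurveSpace k d' :=
  projInclusion (restrictTotalDegree_mono k h)

instance (k : Type*) [Field k] : DirectedSystem (OperatorSpace k) (operatorEmb k · · ·) where
  map_self _ q := by induction q using Projectivization.ind with | h v hv => rfl
  map_map _ _ _ _ _ q := by induction q using Projectivization.ind with | h v hv => rfl

instance (k : Type*) [Field k] : DirectedSystem (CurveSpace k) (curveEmb k · · ·) where
  map_self _ q := by induction q using Projectivization.ind with | h v hv => rfl
  map_map _ _ _ _ _ q := by induction q using Projectivization.ind with | h v hv => rfl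

/-- `A_{1,k} / k^×`, the direct limit of the projective spaces `F_d / k^×`. -/
abbrev IndOperatorSpace (k : Type*) [Field k] : Type _ :=
  DirectLimit (OperatorSpace k) (operatorEmb k)

/-- The space of all planar algebraic curves, the direct limit of the projective spaces `𝔠_d`. -/
abbrev IndCurveSpace (k : Type*) [Field k] : Type _ :=
  DirectLimit (CurveSpace k) (curveEmb k)

section Theta

variable (k : Type*) [Field k] (p : ℕ) [Fact p.Prime] [CharP k p]

/-- `Θ_d : F_d / k^× → 𝔠_d`, sending the class of `L` to the curve cut out by the
`p`-determinant of `L` in the variables `z₁ = x̃^p`, `z₂ = ỹ^p`. -/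
def thetaDeg (d : ℕ) : OperatorSpace k d → CurveSpace k d :=
  Projectivization.lift
    (fun L => Projectivization.mk k
      (⟨WeylAlgebra.curvePoly k p L.1, WeylAlgebra.curvePoly_mem k p L.1.2⟩ :
        MvPolynomial.restrictTotalDegree (Fin 2) k d)
      (fun h => WeylAlgebra.curvePoly_ne_zero k p L.1.2
        (fun h' => L.2 (Subtype.ext h')) (congrArg Subtype.val h)))
    (by
      rintro ⟨a, ha⟩ ⟨b, hb⟩ t h
      rw [Projectivization.mk_eq_mk_iff']
      refine ⟨t ^ p, Subtype.ext ?_⟩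
      dsimp only at h
      subst h
      exact (WeylAlgebra.curvePoly_smul k p t _).symm)

theorem curveEmb_thetaDeg (d d' : ℕ) (h : d ≤ d') (q : OperatorSpace k d) :
    curveEmb k d d' h (thetaDeg k p d q) = thetaDeg k p d' (operatorEmb k d d' h q) := by
  induction q using Projectivization.ind with | h v hv => rfl

/-- `Θ : A_{1,k} / k^× → 𝔠(𝔸²)`, the direct limit of the maps `Θ_d`. -/
def theta : IndOperatorSpace k → IndCurveSpace k :=
  DirectLimit.map (operatorEmb k) (curveEmb k) (thetaDeg k p) (curveEmb_thetaDeg k p)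

end Theta

/-- A map of projective spaces (sets of points over an algebraically closed field `k`) is a
morphism if it is given, in homogeneous coordinates, by homogeneous polynomials of one and the same degree without a common zero (a notion independent
of the choice of coordinates). -/
def IsProjMorphism {k V W : Type*} [Field k] [AddCommGroup V] [Module k V] [Module.Finite k V]
    [AddCommGroup W] [Module k W] [Module.Finite k W] (φ : ℙ k V → ℙ k W) : Prop :=
  ∃ (e : ℕ) (F : Fin (Module.finrank k W) → MvPolynomial (Fin (Module.finrank k V)) k),
    (∀ j, (F j).IsHomogeneous e) ∧
    ∀ (v : V) (hv : v ≠ 0),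
      ∃ hw : ∑ j, MvPolynomial.eval ((Module.finBasis k V).repr v) (F j) • Module.finBasis k W j ≠ 0,
        φ (Projectivization.mk k v hv) = Projectivization.mk k _ hw

end

/-! The splitting is linear in `L`, so its determinant is a form of degree `p` in the coefficients
of `L`; reading off the coefficients in `z₁`, `z₂` is linear. So `Θ_d` is given by forms of degree
`p` (`exists_eval_eq_curvePoly`), and they have no common zero except the origin because `Det_p`
does not vanish on non-zero operators.

Surjectivity is a dimension count. Normal ordering identifies `F_d` with the polynomials of degree
at most `d` (`finrank_bernstein`), so there are as many forms as unknowns. By the Nullstellensatz,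
the polynomial ring is finite over the subalgebra generated by the forms
(`finite_adjoin_range_of_isHomogeneous`). Comparing transcendence degrees, the forms are
algebraically independent, so they can be assigned arbitrary values; lying over turns such an
assignment into a point of affine space (`exists_eval_eq_of_isHomogeneous`). The map is thus onto
already before passing to projective spaces. The limit `Θ` is onto because every point of the target
comes from some finite level. -/

/-! ### Systems of forms whose only common zero is the origin -/

namespace MvPolynomial

/-- Multiplication by `g` raises degrees by exactly `e`. The bound `e ≤ n` keeps the truncated
subtraction honest. -/
theorem homogeneousComponent_mul_of_isHomogeneous {σ R : Type*} [CommSemiring R] {e n : ℕ}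
    {g : MvPolynomial σ R} (hg : g.IsHomogeneous e) (he : e ≤ n) (f : MvPolynomial σ R) :
    homogeneousComponent n (f * g) = homogeneousComponent (n - e) f * g := by
  classical
  let _ := gradedAlgebra (σ := σ) (R := R)
  have h := DirectSum.coe_decompose_mul_of_right_mem_of_le (homogeneousSubmodule σ R) (a := f)
    (b := g) (n := n) hg he
  have key : ∀ (q : MvPolynomial σ R) (i : ℕ),
      (DirectSum.decompose (homogeneousSubmodule σ R) q i : MvPolynomial σ R) =
        homogeneousComponent i q := decomposition.decompose'_apply
  rwa [key, key] at h

/-- Homogeneous polynomials of positive degree whose only common zero is the origin generate a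
subalgebra over which the polynomial ring is finite. -/
theorem finite_adjoin_range_of_isHomogeneous {σ ι k : Type*} [Finite σ] [Finite ι] [Field k]
    [IsAlgClosed k] {e : ℕ} (he : 0 < e) (F : ι → MvPolynomial σ k)
    (hF : ∀ j, (F j).IsHomogeneous e) (h0 : ∀ v : σ → k, (∀ j, eval v (F j) = 0) → v = 0) :
    Module.Finite (Algebra.adjoin k (Set.range F)) (MvPolynomial σ k) := by
  cases nonempty_fintype ι
  -- Nullstellensatz: each variable vanishes on the zero locus of `F`, which contains at most the
  -- origin.
  have hrad : idealOfVars σ k ≤ (Ideal.span (Set.range F)).radical := by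
    rw [← vanishingIdeal_zeroLocus_eq_radical (K := k), idealOfVars, Ideal.span_le]
    rintro _ ⟨i, rfl⟩ v hv
    rw [zeroLocus_span] at hv
    have : v = 0 := h0 v fun j => by simpa using hv _ ⟨j, rfl⟩
    simp [this]
  obtain ⟨N, hN⟩ := Ideal.exists_pow_le_of_le_radical_of_fg hrad (idealOfVars_fg σ k)
  let S := Algebra.adjoin k (Set.range F)
  -- From degree `N + e` on, a form lies in the `N`-th power of the ideal of variables, hence in the
  -- ideal of `F`, and its degree is at least `e`. Both facts feed the induction on the degree.
  let T : Set (MvPolynomial σ k) := (fun m => monomial m 1) '' {m | m.degree < N + e}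
  have hT : T.Finite := (Finsupp.finite_of_degree_lt (N + e)).image _
  have hmem : ∀ n (g : MvPolynomial σ k), g.IsHomogeneous n → g ∈ Submodule.span S T := by
    intro n
    induction n using Nat.strong_induction_on with
    | _ n ih =>
      intro g hg
      by_cases hn : n < N + e
      · rw [g.as_sum]
        refine Submodule.sum_mem _ fun m hm => ?_
        have h1 : monomial m (coeff m g) = algebraMap k S (coeff m g) • monomial m (1 : k) := by
          rw [algebraMap_smul, smul_monomial, smul_eq_mul, mul_one]
        rw [h1]
        refine Submodule.smul_mem _ _ (Submodule.subset_span ⟨m, ?_, rfl⟩)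
        have h2 : m.degree = n := by
          by_contra h
          exact mem_support_iff.1 hm (hg.coeff_eq_zero h)
        exact lt_of_eq_of_lt h2 hn
      · have h1 : g ∈ Ideal.span (Set.range F) := hN <| by
          rw [mem_pow_idealOfVars_iff']
          intro m hm
          refine hg.coeff_eq_zero ?_
          omega
        obtain ⟨c, hc⟩ := Ideal.mem_span_range_iff_exists_fun.1 h1
        -- Keeping only the degree `n` part of the relation makes the coefficients homogeneous of
        -- degree `n - e`, which is smaller than `n` since `e > 0`.
        have h2 : g = ∑ j, (⟨F j, Algebra.subset_adjoin ⟨j, rfl⟩⟩ : S) •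
            homogeneousComponent (n - e) (c j) := by
          have h3 := congrArg (homogeneousComponent n) hc
          rw [homogeneousComponent_of_mem hg, if_pos rfl, map_sum] at h3
          rw [← h3]
          refine Finset.sum_congr rfl fun j _ => ?_
          rw [homogeneousComponent_mul_of_isHomogeneous (hF j) (by omega), mul_comm]
          rfl
        rw [h2]
        exact Submodule.sum_mem _ fun j _ => Submodule.smul_mem _ _
          (ih _ (by omega) _ (homogeneousComponent_isHomogeneous _ _))
  refine Module.finite_def.2 ((Submodule.fg_def).2 ⟨T, hT, eq_top_iff.2 fun g _ => ?_⟩)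
  rw [← sum_homogeneousComponent g]
  exact Submodule.sum_mem _ fun i _ => hmem i _ (homogeneousComponent_isHomogeneous _ _)

/-- As many homogeneous polynomials of one positive degree as there are variables, whose only
common zero is the origin, define a surjective self-map of affine space. -/
theorem exists_eval_eq_of_isHomogeneous {σ k : Type*} [Finite σ] [Field k] [IsAlgClosed k]
    {e : ℕ} (he : 0 < e) (F : σ → MvPolynomial σ k) (hF : ∀ j, (F j).IsHomogeneous e)
    (h0 : ∀ v : σ → k, (∀ j, eval v (F j) = 0) → v = 0) (c : σ → k) :
    ∃ v : σ → k, ∀ j, eval v (F j) = c j := by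
  have hfin := finite_adjoin_range_of_isHomogeneous he F hF h0
  have hint : Algebra.IsIntegral (Algebra.adjoin k (Set.range F)) (MvPolynomial σ k) :=
    inferInstance
  -- The polynomial ring is algebraic over `k[F]`, and `F` has no more members than the
  -- transcendence degree, so `F` is a transcendence basis.
  have hind : AlgebraicIndependent k F := by
    refine (Algebra.IsAlgebraic.isTranscendenceBasis_of_lift_le_trdeg_of_finite k F ?_).1
    rw [trdeg_of_isDomain]
    simp
  -- By independence, `F j ↦ c j` extends to a character of `k[F]`.
  let χ : Algebra.adjoin k (Set.range F) →ₐ[k] k :=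
    (aeval c).comp hind.aevalEquiv.symm.toAlgHom
  have hχ : ∀ j, χ ⟨F j, Algebra.subset_adjoin ⟨j, rfl⟩⟩ = c j := by
    intro j
    have h1 : hind.aevalEquiv (X j) = ⟨F j, Algebra.subset_adjoin ⟨j, rfl⟩⟩ :=
      Subtype.ext (by simp)
    rw [← h1]
    simp [χ]
  have hmax : (RingHom.ker χ).IsMaximal :=
    RingHom.ker_isMaximal_of_surjective χ fun r => ⟨algebraMap _ _ r, χ.commutes r⟩
  have hker : RingHom.ker (algebraMap (Algebra.adjoin k (Set.range F)) (MvPolynomial σ k)) = ⊥ :=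
    (RingHom.injective_iff_ker_eq_bot _).1 (FaithfulSMul.algebraMap_injective _ _)
  -- Lying over gives a maximal ideal above the kernel of `χ`. By the Nullstellensatz it is the
  -- ideal of a point, and `F j - c j` vanishes there.
  obtain ⟨Q, hQ, hQχ⟩ := Ideal.exists_ideal_over_maximal_of_isIntegral
    (S := MvPolynomial σ k) (RingHom.ker χ) (hker.trans_le bot_le)
  obtain ⟨v, rfl⟩ := isMaximal_iff_eq_vanishingIdeal_singleton.1 hQ
  refine ⟨v, fun j => ?_⟩
  have h1 : (⟨F j, Algebra.subset_adjoin ⟨j, rfl⟩⟩ - algebraMap k _ (c j) :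
      Algebra.adjoin k (Set.range F)) ∈ RingHom.ker χ := by
    rw [RingHom.mem_ker, map_sub, hχ, χ.commutes]
    simp
  rw [← hQχ, Ideal.mem_comap, mem_vanishingIdeal_singleton_iff, map_sub, map_sub] at h1
  have h2 := sub_eq_zero.1 h1
  simpa [← IsScalarTower.algebraMap_apply] using h2

/-! ### Determinants as forms in the coefficients of a linear combination -/

/-- Apply `l` to the coefficients of `Q`. Monomials at a point with coordinates in `k` are scalars
from `k`, so `k`-linearity suffices and `l` need not be multiplicative. -/
theorem IsHomogeneous.exists_eval_eq_linearMap {ι k R : Type*} [CommRing k] [CommRing R]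
    [Algebra k R] {e : ℕ} {Q : MvPolynomial ι R} (hQ : Q.IsHomogeneous e) (l : R →ₗ[k] k) :
    ∃ F : MvPolynomial ι k, F.IsHomogeneous e ∧
      ∀ v : ι → k, eval v F = l (eval (fun i => algebraMap k R (v i)) Q) := by
  refine ⟨∑ m ∈ Q.support, monomial m (l (coeff m Q)), ?_, fun v => ?_⟩
  · refine IsHomogeneous.sum _ _ _ fun m hm => isHomogeneous_monomial _ ?_
    by_contra h
    exact mem_support_iff.1 hm (hQ.coeff_eq_zero h)
  · rw [map_sum, eval_eq, map_sum]
    refine Finset.sum_congr rfl fun m _ => ?_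
    simp_rw [← map_pow]
    rw [eval_monomial, ← map_prod, mul_comm (coeff m Q), ← Algebra.smul_def, map_smul, mul_comm]
    rfl

/-- A linear functional of the determinant of a linear combination of matrices is a homogeneous
polynomial in the coefficients of the combination. -/
theorem exists_eval_eq_det_sum_smul {ι n k R : Type*} [Fintype ι] [Fintype n] [DecidableEq n]
    [CommRing k] [CommRing R] [Algebra k R] (A : ι → Matrix n n R) (l : R →ₗ[k] k) :
    ∃ F : MvPolynomial ι k, F.IsHomogeneous (Fintype.card n) ∧
      ∀ v : ι → k, eval v F = l (∑ i, v i • A i).det := by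
  -- The generic linear combination: its entries are linear forms, and it specializes to the given
  -- one.
  let M : Matrix n n (MvPolynomial ι R) := Matrix.of fun a b => ∑ i, C (A i a b) * X i
  have hM : ∀ a b, (M a b).IsHomogeneous 1 := fun a b =>
    IsHomogeneous.sum _ _ _ fun i _ => isHomogeneous_C_mul_X _ _
  have hdet : M.det.IsHomogeneous (Fintype.card n) := by
    rw [Matrix.det_apply]
    refine IsHomogeneous.sum _ _ _ fun τ _ => ?_
    rw [Units.smul_def]
    refine (homogeneousSubmodule ι R (Fintype.card n)).toAddSubgroup.zsmul_mem ?_ _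
    simpa using IsHomogeneous.prod Finset.univ (fun i => M (τ i) i) (fun _ => 1) fun i _ => hM _ _
  obtain ⟨F, hF, hl⟩ := hdet.exists_eval_eq_linearMap l
  refine ⟨F, hF, fun v => ?_⟩
  rw [hl, RingHom.map_det]
  congr 2
  ext a b
  simp only [M, RingHom.mapMatrix_apply, Matrix.map_apply, Matrix.of_apply, map_sum, map_mul,
    eval_C, eval_X, Matrix.sum_apply, Matrix.smul_apply]
  simp only [Algebra.smul_def, mul_comm]

end MvPolynomial

/-! ### From affine to projective surjectivity -/

/-- A map between projective spaces of the same dimension that is given in coordinates by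
homogeneous polynomials of one positive degree without common zeros is surjective. -/
theorem surjective_of_isHomogeneous_coordinates {k V W : Type*} [Field k] [IsAlgClosed k]
    [AddCommGroup V] [Module k V] [AddCommGroup W] [Module k W] {ι : Type*} [Fintype ι]
    (b : Module.Basis ι k V) (c : Module.Basis ι k W) {e : ℕ} (he : 0 < e)
    (F : ι → MvPolynomial ι k) (hF : ∀ j, (F j).IsHomogeneous e) (φ : ℙ k V → ℙ k W)
    (hφ : ∀ (v : V) (hv : v ≠ 0), ∃ hw : ∑ j, MvPolynomial.eval (b.repr v) (F j) • c j ≠ 0,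
      φ (Projectivization.mk k v hv) = Projectivization.mk k _ hw) :
    Function.Surjective φ := by
  have h0 : ∀ v : ι → k, (∀ j, MvPolynomial.eval v (F j) = 0) → v = 0 := by
    intro v hv
    by_contra hne
    have h1 : b.equivFun.symm v ≠ 0 := fun h => hne ((LinearEquiv.map_eq_zero_iff _).1 h)
    obtain ⟨hw, -⟩ := hφ _ h1
    refine hw (Finset.sum_eq_zero fun j _ => ?_)
    rw [← Module.Basis.equivFun_apply, LinearEquiv.apply_symm_apply, hv, zero_smul]
  intro q
  induction q using Projectivization.ind with
  | h w hw =>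
    obtain ⟨v, hv⟩ := MvPolynomial.exists_eval_eq_of_isHomogeneous he F hF h0 (c.repr w)
    have h1 : ∑ j, MvPolynomial.eval (b.repr (b.equivFun.symm v)) (F j) • c j = w := by
      rw [← Module.Basis.equivFun_apply, LinearEquiv.apply_symm_apply]
      simp_rw [hv]
      exact c.sum_repr w
    -- Forms of positive degree vanish at the origin, so the origin cannot be a preimage of `w ≠ 0`.
    have h2 : b.equivFun.symm v ≠ 0 := by
      intro h
      have hv0 : v = 0 := (LinearEquiv.map_eq_zero_iff _).1 h
      refine hw ?_
      rw [← c.sum_repr w]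
      refine Finset.sum_eq_zero fun j _ => ?_
      rw [← hv j, hv0, MvPolynomial.eval_zero, MvPolynomial.constantCoeff_eq,
        (hF j).coeff_eq_zero (by simpa using he.ne), zero_smul]
    obtain ⟨hw', h3⟩ := hφ _ h2
    refine ⟨_, h3.trans ?_⟩
    simp only [h1]

/-! ### Dimension of the Bernstein filtration and coordinates for the determinant -/

namespace WeylAlgebra

instance free_bernstein (k : Type*) [Field k] (d : ℕ) : Module.Free k (bernstein k d) :=
  Module.Free.of_divisionRing k (bernstein k d)

theorem normalOrder_mem_bernstein (k : Type*) [CommRing k] {d : ℕ} {f : MvPolynomial (Fin 2) k}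
    (hf : f.totalDegree ≤ d) : normalOrder k f ∈ bernstein k d := by
  rw [f.as_sum, map_sum]
  refine Submodule.sum_mem _ fun m hm => ?_
  rw [normalOrder_monomial]
  refine Submodule.smul_mem _ _ (Submodule.subset_span ⟨m 0, m 1, ?_, rfl⟩)
  have h := MvPolynomial.le_totalDegree hm
  rw [Finsupp.sum_fintype _ _ (fun _ => rfl), Fin.sum_univ_two] at h
  exact h.trans hf

/-- The leading form of `f` can be recovered after splitting: its `p`-th power is the top part of
the determinant. If the operator is zero, this power is zero, so `f` has no leading form. -/
theorem normalOrder_injective (k : Type*) [Field k] (p : ℕ) [Fact p.Prime] [CharP k p] : Function.Injective (normalOrder k) := by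
  refine (injective_iff_map_eq_zero _).2 fun f hf => ?_
  by_contra hf0
  have h1 := (hasTop_normalOrder k p f.totalDegree f le_rfl).det.2
  -- An empty zero matrix would have determinant `1`.
  have : Nonempty (Fin p) := ⟨⟨0, (Fact.out : p.Prime).pos⟩⟩
  rw [hf, map_zero, Matrix.det_zero, map_zero] at h1
  have h2 : MvPolynomial.homogeneousComponent f.totalDegree f = 0 := by
    by_contra hne
    exact pow_ne_zero p hne h1.symm
  obtain ⟨m, hm, hm'⟩ := f.support.exists_mem_eq_sup
    (MvPolynomial.support_nonempty.2 hf0) (fun m => m.sum fun _ e => e)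
  have h3 := congrArg (MvPolynomial.coeff m) h2
  rw [MvPolynomial.coeff_homogeneousComponent, if_pos (by rw [MvPolynomial.totalDegree, hm']; rfl),
    MvPolynomial.coeff_zero] at h3
  exact MvPolynomial.mem_support_iff.1 hm h3

theorem finrank_bernstein (k : Type*) [Field k] (p : ℕ) [Fact p.Prime] [CharP k p] (d : ℕ) :
    Module.finrank k (bernstein k d) =
    Module.finrank k (MvPolynomial.restrictTotalDegree (Fin 2) k d) := by
  have h : bernstein k d = (MvPolynomial.restrictTotalDegree (Fin 2) k d).map (normalOrder k) := by
    ext L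
    constructor
    · intro hL
      obtain ⟨f, hf, rfl⟩ := exists_normalOrder_eq k d L hL
      exact ⟨f, (MvPolynomial.mem_restrictTotalDegree _ _ _).2 hf, rfl⟩
    · rintro ⟨f, hf, rfl⟩
      exact normalOrder_mem_bernstein k ((MvPolynomial.mem_restrictTotalDegree _ _ _).1 hf)
  rw [h]
  exact (Submodule.equivMapOfInjective _ (normalOrder_injective k p) _).finrank_eq.symm

/-- Indexing by the dimension of the target lets unknowns and equations share one index type. -/
theorem nonempty_basis_bernstein (k : Type*) [Field k] (p : ℕ) [Fact p.Prime] [CharP k p]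
    (d : ℕ) : Nonempty (Module.Basis
      (Fin (Module.finrank k (MvPolynomial.restrictTotalDegree (Fin 2) k d))) k
      (bernstein k d)) :=
  ⟨(Module.finBasis k (bernstein k d)).reindex (finCongr (finrank_bernstein k p d))⟩

/-- In linear coordinates, `Det_p` on `F_d` is given by homogeneous polynomials of degree `p`. -/
theorem exists_eval_eq_curvePoly (k : Type*) [Field k] (p : ℕ) [Fact p.Prime] [CharP k p]
    {d : ℕ} {ι κ : Type*} [Fintype ι] [Fintype κ]
    (b : Module.Basis ι k (bernstein k d))
    (c : Module.Basis κ k (MvPolynomial.restrictTotalDegree (Fin 2) k d)) :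
    ∃ F : κ → MvPolynomial ι k, (∀ j, (F j).IsHomogeneous p) ∧ ∀ L : bernstein k d,
      ∑ j, MvPolynomial.eval (b.repr L) (F j) • c j =
        ⟨curvePoly k p L, curvePoly_mem k p L.2⟩ := by
  -- A linear left inverse of `E` undoes `z₁ = x̃^p`, `z₂ = ỹ^p`, so each coordinate of the curve
  -- becomes a linear functional of the determinant.
  let E : MvPolynomial.restrictTotalDegree (Fin 2) k d →ₗ[k] MvPolynomial (Fin 2) k :=
    (MvPolynomial.expand p).toLinearMap.comp (Submodule.subtype _)
  have hE : Function.Injective E :=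
    (MvPolynomial.expand_injective (Fact.out : p.Prime).pos).comp Subtype.val_injective
  obtain ⟨r, hr⟩ := E.exists_leftInverse_of_injective (LinearMap.ker_eq_bot.2 hE)
  choose F hF hF' using fun j => MvPolynomial.exists_eval_eq_det_sum_smul
    (fun i => splitting k p (b i : WeylAlgebra k)) (c.coord j ∘ₗ r)
  refine ⟨F, fun j => by simpa using hF j, fun L => ?_⟩
  have hL : ∑ i, b.repr L i • splitting k p (b i : WeylAlgebra k) = splitting k p L := by
    conv_rhs => rw [← b.sum_repr L]
    rw [Submodule.coe_sum, map_sum]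
    exact Finset.sum_congr rfl fun i _ => by rw [Submodule.coe_smul, map_smul]
  have hr' : r (pDet k p L) = ⟨curvePoly k p L, curvePoly_mem k p L.2⟩ := by
    rw [← expand_curvePoly]
    exact LinearMap.congr_fun hr ⟨curvePoly k p L, curvePoly_mem k p L.2⟩
  simp_rw [hF', hL, LinearMap.comp_apply]
  change ∑ j, c.coord j (r (pDet k p L)) • c j = _
  rw [hr']
  exact c.sum_repr _

end WeylAlgebra

/-! ### The maps `Θ_d` and their limit -/

theorem thetaDeg_mk_of_coordinates (k : Type*) [Field k] (p : ℕ) [Fact p.Prime] [CharP k p]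
    {d : ℕ} (v : WeylAlgebra.bernstein k d) (hv : v ≠ 0)
    {w : MvPolynomial.restrictTotalDegree (Fin 2) k d}
    (h : w = ⟨WeylAlgebra.curvePoly k p v, WeylAlgebra.curvePoly_mem k p v.2⟩) :
    ∃ hw : w ≠ 0, thetaDeg k p d (Projectivization.mk k v hv) = Projectivization.mk k w hw := by
  subst h
  exact ⟨fun h => WeylAlgebra.curvePoly_ne_zero k p v.2 (fun h' => hv (Subtype.ext h'))
    (congrArg Subtype.val h), rfl⟩

theorem isProjMorphism_thetaDeg (k : Type*) [Field k] (p : ℕ) [Fact p.Prime] [CharP k p]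
    (d : ℕ) : IsProjMorphism (thetaDeg k p d) := by
  obtain ⟨F, hF, hF'⟩ := WeylAlgebra.exists_eval_eq_curvePoly k p
    (Module.finBasis k (WeylAlgebra.bernstein k d))
    (Module.finBasis k (MvPolynomial.restrictTotalDegree (Fin 2) k d))
  exact ⟨p, F, hF, fun v hv => thetaDeg_mk_of_coordinates k p v hv (hF' v)⟩

/-- The forms are taken in the reindexed basis of `F_d`, since the argument needs a square system;
their degree `p` is positive. -/
theorem surjective_thetaDeg (k : Type*) [Field k] [IsAlgClosed k] (p : ℕ) [Fact p.Prime]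
    [CharP k p] (d : ℕ) : Function.Surjective (thetaDeg k p d) := by
  obtain ⟨b⟩ := WeylAlgebra.nonempty_basis_bernstein k p d
  obtain ⟨F, hF, hF'⟩ := WeylAlgebra.exists_eval_eq_curvePoly k p b
    (Module.finBasis k (MvPolynomial.restrictTotalDegree (Fin 2) k d))
  refine surjective_of_isHomogeneous_coordinates b
    (Module.finBasis k (MvPolynomial.restrictTotalDegree (Fin 2) k d))
    (Fact.out : p.Prime).pos F hF (thetaDeg k p d) fun v hv => ?_
  exact thetaDeg_mk_of_coordinates k p v hv (hF' v)

theorem theorem3p6 (k : Type*) [Field k] [IsAlgClosed k] (p : ℕ) [Fact p.Prime] [CharP k p] :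
    (∀ d : ℕ, IsProjMorphism (thetaDeg k p d) ∧ Function.Surjective (thetaDeg k p d)) ∧
      Function.Surjective (theta k p) := by
  refine ⟨fun d => ⟨isProjMorphism_thetaDeg k p d, surjective_thetaDeg k p d⟩, fun q => ?_⟩
  induction q using DirectLimit.induction with
  | _ d q =>
    obtain ⟨L, rfl⟩ := surjective_thetaDeg k p d q
    -- The limit map acts on representatives level by level.
    exact ⟨⟦⟨d, L⟩⟧, rfl⟩
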